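/- Let $p$ be a prime and let $(R,\mathfrak m,k)$ be a complete Noetherian local ring of characteristic $p$ that is F-finite, i.e. the Frobenius endomorphism $x\mapsto x^p$ of $R$ is finite. For a ring $A$ of characteristic $p$ and $e\in\mathbb N$, write $F^e_*A$ (also written $A^{1/p^e}$) for the abelian group $A$ regarded as an $A$-module via $r\cdot x=r^{p^e}x$, and let the $e$-th Frobenius splitting number $a_e(A)$ be the largest rank of a free $A$-module onto which $F^e_*A$ surjects. A sequence $\underline f=f_1,\dots,f_c$ of elements of $\mathfrak m$ is called a parameter sequence if $\dim R/(f_1,\dots,f_{i+1})<\dim R/(f_1,\dots,f_i)$ for all $0\le i<c$. Then for every parameter sequence $\underline f=f_1,\dots,f_c$ in $R$ and every positive integer $e$ there exists an integer $N\ge 0$ such that for all $\underline\epsilon=\epsilon_1,\dots,\epsilon_c$ with every $\epsilon_i\in\mathfrak m^N$, $$a_e\bigl(R/(f_1+\epsilon_1,\dots,f_c+\epsilon_c)\bigr)\le a_e\bigl(R/(f_1,\dots,f_c)\bigr).$$ That is, the function $\underline g\mapsto a_e(R/(\underline g))$ has a local maximum at $\underline f$ in the $\mathfrak m$-adic topology.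 -/

import Mathlib

/-- The `e`-th iterate `x ↦ x ^ (p ^ e)` of the Frobenius endomorphism of a commutative ring `A` of
prime characteristic `p`. Characteristic `p` is expressed as being an algebra over the field with
`p` elements, a structure that every quotient ring inherits. -/
def frobeniusPow (p e : ℕ) [Fact p.Prime] (A : Type*) [CommRing A] [Algebra (ZMod p) A] :
    A →+* A where
  toFun x := x ^ p ^ e
  map_one' := one_pow _
  map_mul' x y := mul_pow x y _
  map_zero' := zero_pow (pow_ne_zero e (Fact.out : p.Prime).ne_zero)
  map_add' x y := by
    cases subsingleton_or_nontrivial A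
    · exact Subsingleton.elim _ _
    · have : CharP A p := charP_of_injective_algebraMap (algebraMap (ZMod p) A).injective p
      exact add_pow_char_pow x y p e

/-- This is Mathlib's iterated Frobenius whenever the latter is available. -/
theorem frobeniusPow_eq_iterateFrobenius (p e : ℕ) [Fact p.Prime] (A : Type*) [CommRing A]
    [Algebra (ZMod p) A] [ExpChar A p] : frobeniusPow p e A = iterateFrobenius A p e :=
  RingHom.ext fun _ => rfl

/-- The module `F^e_* A`, isomorphic to `A^{1/p^e}` when `A` is reduced: the additive group of `A`,
on which `A` acts through the `e`-th iterate of Frobenius. -/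
def FrobeniusPushforward (_p _e : ℕ) (A : Type*) : Type _ := A

instance FrobeniusPushforward.instAddCommGroup (p e : ℕ) (A : Type*) [CommRing A] :
    AddCommGroup (FrobeniusPushforward p e A) :=
  inferInstanceAs (AddCommGroup A)

instance FrobeniusPushforward.instModule (p e : ℕ) [Fact p.Prime] (A : Type*) [CommRing A]
    [Algebra (ZMod p) A] : Module A (FrobeniusPushforward p e A) :=
  Module.compHom (M := A) (frobeniusPow p e A)

/-- The action of `r` on `F^e_* A` is multiplication by `r ^ (p ^ e)`. -/
theorem FrobeniusPushforward.smul_def (p e : ℕ) [Fact p.Prime] (A : Type*) [CommRing A]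
    [Algebra (ZMod p) A] (r x : A) :
    (r • (show FrobeniusPushforward p e A from x) : FrobeniusPushforward p e A) =
      (r ^ p ^ e * x : A) :=
  rfl

/-- A ring of prime characteristic `p` is F-finite if its Frobenius endomorphism is finite. -/
def IsFFinite (p : ℕ) [Fact p.Prime] (A : Type*) [CommRing A] [Algebra (ZMod p) A] : Prop :=
  Module.Finite A (FrobeniusPushforward p 1 A)

/-- `frk M`: the largest rank of a free module onto which `M` surjects. -/
noncomputable def freeRank (A M : Type*) [CommRing A] [AddCommGroup M] [Module A M] : ℕ :=
  sSup {n : ℕ | ∃ φ : M →ₗ[A] (Fin n → A), Function.Surjective φ}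

/-- For a finitely generated module over a nonzero ring the supremum in `freeRank` is a maximum. -/
theorem freeRank_isGreatest (A M : Type*) [CommRing A] [Nontrivial A] [AddCommGroup M] [Module A M]
    [Module.Finite A M] :
    IsGreatest {n : ℕ | ∃ φ : M →ₗ[A] (Fin n → A), Function.Surjective φ} (freeRank A M) := by
  obtain ⟨m, g, hg⟩ := Module.Finite.exists_fin' A M
  have hb : BddAbove {n : ℕ | ∃ φ : M →ₗ[A] (Fin n → A), Function.Surjective φ} := by
    refine ⟨m, ?_⟩
    rintro n ⟨φ, hφ⟩
    exact le_of_fin_surjective A (φ.comp g) (hφ.comp hg)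
  exact ⟨Nat.sSup_mem ⟨0, 0, fun y => ⟨0, Subsingleton.elim _ _⟩⟩ hb, fun _ hn => le_csSup hb hn⟩

/-- The `e`-th Frobenius splitting number `a_e(A) = frk (F^e_* A)`. -/
noncomputable def splittingNumber (p e : ℕ) [Fact p.Prime] (A : Type*) [CommRing A]
    [Algebra (ZMod p) A] : ℕ :=
  freeRank A (FrobeniusPushforward p e A)

/-- A sequence `f_1, …, f_c` in the maximal ideal is a parameter sequence if
`dim R/(f_1, …, f_{i+1}) < dim R/(f_1, …, f_i)` for `i = 0, …, c - 1`. -/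
def IsParameterSequence {R : Type*} [CommRing R] [IsLocalRing R] {c : ℕ} (f : Fin c → R) : Prop :=
  (∀ i, f i ∈ IsLocalRing.maximalIdeal R) ∧
    ∀ i : Fin c, ringKrullDim (R ⧸ Ideal.span (f '' Set.Iic i)) <
      ringKrullDim (R ⧸ Ideal.span (f '' Set.Iio i))

open IsLocalRing

/-! Let `F` and `G` be the ideals of the original and the perturbed sequence, `𝔪` the maximal ideal
and `q = p ^ e`. A surjection from `F^e_* (R ⧸ G)` to a free module of rank `n` is transported to `R
⧸ F`. Its components send the Frobenius power `J ^ [q]` of `J = 𝔪 ^ k` into `J`, so if `F` and `G`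
agree modulo `J ^ [q]` they induce maps from `F^e_* (R ⧸ F)` to `R ⧸ F` modulo `𝔪 ^ k`. For large
`k`, depending only on `F` and `e`, Artin–Rees replaces these by honest linear forms with the same
values modulo `𝔪`, and Nakayama makes the resulting map to `(R ⧸ F) ^ n` surjective. -/

/-- By Artin–Rees, a linear map to `A ⧸ I ^ k` with `k` large agrees modulo `I` with a linear map
to `A`. -/
theorem exists_pow_forall_exists_linearMap_sub_mem {A M : Type*} [CommRing A] [IsNoetherianRing A]
    [AddCommGroup M] [Module A M] [Module.Finite A M] (I : Ideal A) :
    ∃ k : ℕ, 0 < k ∧ ∀ φ : M →ₗ[A] A ⧸ I ^ k, ∃ ψ : M →ₗ[A] A,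
      ∀ x a, Ideal.Quotient.mk (I ^ k) a = φ x → ψ x - a ∈ I := by
  obtain ⟨n, π, hπ⟩ := Module.Finite.exists_fin' A M
  obtain ⟨m, r, hr⟩ := Submodule.fg_iff_exists_fin_generating_family.mp
    (IsNoetherian.noetherian (LinearMap.ker π))
  -- The rows of `T` generate the relations of `M`, so `x` defines a linear form on `M` exactly when
  -- `T x = 0`.
  let T : (Fin n → A) →ₗ[A] (Fin m → A) := Matrix.mulVecLin (Matrix.of r)
  have hT (x : Fin n → A) (j : Fin m) : T x j = ∑ i, r j i * x i := by
    simp [T, Matrix.mulVec, dotProduct]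
  obtain ⟨k, hk⟩ := Ideal.exists_pow_inf_eq_pow_smul I (LinearMap.range T)
  -- One power beyond the Artin–Rees constant leaves a factor `I`: then `T x = T y` with `y` in `I •
  -- ⊤`, and `x - y` gives the corrected form.
  refine ⟨k + 1, k.succ_pos, fun φ => ?_⟩
  choose x hx using fun i => Ideal.Quotient.mk_surjective (φ (π (Pi.single i 1)))
  have hφ (v : Fin n → A) : φ (π v) = Ideal.Quotient.mk (I ^ (k + 1)) (∑ i, v i * x i) := by
    conv_lhs => rw [pi_eq_sum_univ' v]
    simp only [map_sum, map_smul, map_mul, hx]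
    refine Finset.sum_congr rfl fun i _ => ?_
    rw [Algebra.smul_def, Ideal.Quotient.algebraMap_eq]
  have hTx : T x ∈ I ^ (k + 1) • (⊤ : Submodule A (Fin m → A)) ⊓ LinearMap.range T := by
    refine ⟨?_, x, rfl⟩
    rw [pi_eq_sum_univ' (T x)]
    refine Submodule.sum_mem _ fun j _ => Submodule.smul_mem_smul ?_ trivial
    have hrj : π (r j) = 0 := by
      rw [← LinearMap.mem_ker, ← hr]
      exact Submodule.subset_span ⟨j, rfl⟩
    rw [hT, ← Ideal.Quotient.eq_zero_iff_mem, ← hφ, hrj, map_zero]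
  rw [hk (k + 1) k.le_succ, Nat.add_sub_cancel_left, pow_one] at hTx
  have hTx' : T x ∈ Submodule.map T (I • ⊤) := by
    rw [Submodule.map_smul'', Submodule.map_top]
    exact Submodule.smul_mono le_rfl inf_le_right hTx
  obtain ⟨y, hy, hxy⟩ := hTx'
  have hyI (i : Fin n) : y i ∈ I := by
    have := Submodule.mem_map_of_mem (f := LinearMap.proj (R := A) (φ := fun _ : Fin n => A) i) hy
    rw [Submodule.map_smul''] at this
    simpa using Submodule.smul_mono (le_refl I) le_top this
  let ξ : (Fin n → A) →ₗ[A] A := Fintype.linearCombination A (x - y)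
  have hξ (v : Fin n → A) : ξ v = ∑ i, v i * (x i - y i) := by
    simp [ξ, Fintype.linearCombination_apply]
  have hker : LinearMap.ker π ≤ LinearMap.ker ξ := by
    rw [← hr, Submodule.span_le]
    rintro _ ⟨j, rfl⟩
    have := congrFun hxy j
    rw [hT, hT] at this
    simp [hξ, mul_sub, this]
  refine ⟨(LinearMap.ker π).liftQ ξ hker ∘ₗ (π.quotKerEquivOfSurjective hπ).symm.toLinearMap,
    fun z a ha => ?_⟩
  obtain ⟨v, rfl⟩ := hπ z
  have hv : (π.quotKerEquivOfSurjective hπ).symm (π v) = (LinearMap.ker π).mkQ v := by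
    rw [LinearEquiv.symm_apply_eq]; rfl
  rw [hφ, Ideal.Quotient.eq] at ha
  have ha' := Ideal.pow_le_self k.succ_ne_zero ha
  have hs : ∑ i, v i * y i ∈ I := I.sum_mem fun i _ => I.mul_mem_left _ (hyI i)
  have : ξ v - a = -(a - ∑ i, v i * x i) - ∑ i, v i * y i := by
    rw [hξ]; simp only [mul_sub, Finset.sum_sub_distrib]; ring
  simp only [LinearMap.comp_apply, LinearEquiv.coe_coe, hv, Submodule.mkQ_apply,
    Submodule.liftQ_apply]
  rw [this]
  exact I.sub_mem (I.neg_mem ha') hs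

/-- The iterates of a finite Frobenius endomorphism are finite. -/
theorem IsFFinite.finite_frobeniusPow {p : ℕ} [Fact p.Prime] {A : Type*} [CommRing A]
    [Algebra (ZMod p) A] (h : IsFFinite p A) (e : ℕ) : (frobeniusPow p e A).Finite := by
  induction e with
  | zero =>
    convert RingHom.Finite.id A
    ext x
    simp [frobeniusPow]
  | succ e ih =>
    have h1 : (frobeniusPow p 1 A).Finite := h
    convert h1.comp ih
    ext x
    simp [frobeniusPow, pow_succ, pow_mul]

/-- F-finiteness of a ring makes the Frobenius pushforwards of its quotients finite. -/
theorem IsFFinite.finite_frobeniusPushforward_quotient {p : ℕ} [Fact p.Prime] {A : Type*}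
    [CommRing A] [Algebra (ZMod p) A] (h : IsFFinite p A) (e : ℕ) (J : Ideal A) :
    Module.Finite (A ⧸ J) (FrobeniusPushforward p e (A ⧸ J)) := by
  have h1 : ((Ideal.Quotient.mk J).comp (frobeniusPow p e A)).Finite :=
    (RingHom.Finite.of_surjective _ Ideal.Quotient.mk_surjective).comp (h.finite_frobeniusPow e)
  have h2 : (frobeniusPow p e (A ⧸ J)).comp (Ideal.Quotient.mk J) =
      (Ideal.Quotient.mk J).comp (frobeniusPow p e A) := by
    ext x
    simp [frobeniusPow]
  rw [← h2] at h1
  exact RingHom.Finite.of_comp_finite h1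

/-- A linear form on `F^e_* (R ⧸ G)` takes out `p ^ e`-th powers. -/
theorem FrobeniusPushforward.map_mk_pow_mul {p e : ℕ} [Fact p.Prime] {R : Type*} [CommRing R]
    [Algebra (ZMod p) R] {G : Ideal R} (φ : FrobeniusPushforward p e (R ⧸ G) →ₗ[R ⧸ G] R ⧸ G)
    (a x : R) :
    φ (show FrobeniusPushforward p e (R ⧸ G) from Ideal.Quotient.mk G (a ^ p ^ e * x)) =
      Ideal.Quotient.mk G a *
        φ (show FrobeniusPushforward p e (R ⧸ G) from Ideal.Quotient.mk G x) := by
  have h : Ideal.Quotient.mk G (a ^ p ^ e * x) =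
      Ideal.Quotient.mk G a ^ p ^ e * Ideal.Quotient.mk G x := by rw [map_mul, map_pow]
  exact (congrArg φ h).trans (φ.map_smul (Ideal.Quotient.mk G a) _)

/-- A linear form on `F^e_* (R ⧸ G)` maps the image of `J ^ [p ^ e]` into the image of `J`. -/
theorem FrobeniusPushforward.map_mk_mem_map {p e : ℕ} [Fact p.Prime] {R : Type*} [CommRing R]
    [Algebra (ZMod p) R] {G : Ideal R} (φ : FrobeniusPushforward p e (R ⧸ G) →ₗ[R ⧸ G] R ⧸ G)
    (J : Ideal R) {t : R} (ht : t ∈ J.map (frobeniusPow p e R)) :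
    φ (show FrobeniusPushforward p e (R ⧸ G) from Ideal.Quotient.mk G t) ∈
      J.map (Ideal.Quotient.mk G) := by
  -- The factor `b` is carried along because `φ` is not linear for ordinary multiplication on its
  -- source.
  suffices h : ∀ b, φ (show FrobeniusPushforward p e (R ⧸ G) from Ideal.Quotient.mk G (t * b)) ∈
      J.map (Ideal.Quotient.mk G) by simpa using h 1
  induction ht using Submodule.span_induction with
  | zero =>
    intro b
    rw [zero_mul, map_zero]
    exact (map_zero φ).symm ▸ Ideal.zero_mem _
  | add s t _ _ hs ht =>
    intro b
    rw [add_mul, map_add]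
    exact (map_add φ _ _).symm ▸ Ideal.add_mem _ (hs b) (ht b)
  | mem s hs =>
    obtain ⟨y, hy, rfl⟩ := hs
    intro b
    exact (FrobeniusPushforward.map_mk_pow_mul φ y b).symm ▸
      Ideal.mul_mem_right _ _ (Ideal.mem_map_of_mem _ hy)
  | smul a t _ ht =>
    intro b
    rw [smul_eq_mul, mul_comm a, mul_assoc]
    exact ht (a * b)

/-- If `G` and `F` agree modulo a high Frobenius power of `J`, a linear form on `F^e_* (R ⧸ G)`
induces a linear map on `F^e_* (R ⧸ F)` with values in `R ⧸ F` modulo `J`. -/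
theorem FrobeniusPushforward.exists_linearMap_quotient {p e : ℕ} [Fact p.Prime] {R : Type*}
    [CommRing R] [Algebra (ZMod p) R] {F G J : Ideal R} (hFG : F ≤ G ⊔ J.map (frobeniusPow p e R))
    (hGF : G ≤ F ⊔ J) (K : Ideal (R ⧸ F)) (hK : K = J.map (Ideal.Quotient.mk F))
    (φ : FrobeniusPushforward p e (R ⧸ G) →ₗ[R ⧸ G] R ⧸ G) :
    ∃ φ' : FrobeniusPushforward p e (R ⧸ F) →ₗ[R ⧸ F] (R ⧸ F) ⧸ K,
      ∀ x y : R, φ (show FrobeniusPushforward p e (R ⧸ G) from Ideal.Quotient.mk G x) =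
          Ideal.Quotient.mk G y →
        φ' (show FrobeniusPushforward p e (R ⧸ F) from Ideal.Quotient.mk F x) =
          Ideal.Quotient.mk K (Ideal.Quotient.mk F y) := by
  let ρ : R →+* (R ⧸ F) ⧸ K := (Ideal.Quotient.mk K).comp (Ideal.Quotient.mk F)
  have hρJ : ∀ a ∈ J, ρ a = 0 := fun a ha =>
    Ideal.Quotient.eq_zero_iff_mem.mpr (hK ▸ Ideal.mem_map_of_mem _ ha)
  have hρF : ∀ a ∈ F, ρ a = 0 := fun a ha => by
    simp [ρ, Ideal.Quotient.eq_zero_iff_mem.mpr ha]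
  have hρG : ∀ a ∈ G, ρ a = 0 := fun a ha => by
    obtain ⟨u, hu, v, hv, rfl⟩ := Submodule.mem_sup.mp (hGF ha)
    rw [map_add, hρF u hu, hρJ v hv, add_zero]
  let θ : R ⧸ G →+* (R ⧸ F) ⧸ K := Ideal.Quotient.lift G ρ hρG
  have hθ (a : R) : θ (Ideal.Quotient.mk G a) = ρ a := rfl
  -- The descent is done for additive groups, since scalars act on the source through `q`-th powers;
  -- linearity is restored at the end.
  let α : R →+ (R ⧸ F) ⧸ K :=
    (θ : R ⧸ G →+ (R ⧸ F) ⧸ K).comp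
      ((show R ⧸ G →+ R ⧸ G from φ.toAddMonoidHom).comp (Ideal.Quotient.mk G : R →+ R ⧸ G))
  have hα (x : R) : α x =
    θ (φ (show FrobeniusPushforward p e (R ⧸ G) from Ideal.Quotient.mk G x)) := rfl
  have hαG : ∀ a ∈ G, α a = 0 := fun a ha => by
    rw [hα, Ideal.Quotient.eq_zero_iff_mem.mpr ha]
    exact (congrArg θ (map_zero φ)).trans (map_zero θ)
  have hαJ : ∀ a ∈ J.map (frobeniusPow p e R), α a = 0 := fun a ha => by
    have := Ideal.mem_map_of_mem θ (FrobeniusPushforward.map_mk_mem_map φ J ha)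
    rw [Ideal.map_map] at this
    have h0 : J.map (θ.comp (Ideal.Quotient.mk G)) = ⊥ :=
      (Ideal.map_eq_bot_iff_le_ker _).mpr fun a ha => hρJ a ha
    rwa [h0] at this
  have hαF : ∀ a ∈ F, α a = 0 := fun a ha => by
    obtain ⟨u, hu, v, hv, rfl⟩ := Submodule.mem_sup.mp (hFG ha)
    rw [map_add, hαG u hu, hαJ v hv, add_zero]
  let β : R ⧸ F →+ (R ⧸ F) ⧸ K := QuotientAddGroup.lift F.toAddSubgroup α hαF
  have hβ (x : R) : β (Ideal.Quotient.mk F x) = α x := rfl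
  refine ⟨{ toFun := β, map_add' := β.map_add, map_smul' := ?_ }, fun x y h => ?_⟩
  · intro a x
    obtain ⟨a, rfl⟩ := Ideal.Quotient.mk_surjective a
    obtain ⟨x, rfl⟩ := Ideal.Quotient.mk_surjective (show R ⧸ F from x)
    have h1 : β (Ideal.Quotient.mk F (a ^ p ^ e * x)) =
        ρ a * β (Ideal.Quotient.mk F x) := by
      rw [hβ, hβ, hα, hα, ← hθ, ← map_mul]
      exact congrArg θ (FrobeniusPushforward.map_mk_pow_mul φ a x)
    rw [map_mul, map_pow] at h1
    exact h1
  · exact (congrArg θ h : _)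

/-- A linear map to a finite free module over a Noetherian local ring which is surjective modulo
an ideal contained in the maximal ideal is surjective. -/
theorem LinearMap.surjective_of_forall_exists_sub_mem {A M : Type*} [CommRing A] [IsLocalRing A]
    [AddCommGroup M] [Module A M] {n : ℕ} (I : Ideal A) (hI : I ≤ maximalIdeal A)
    (ψ : M →ₗ[A] Fin n → A) (h : ∀ y : Fin n → A, ∃ x, ∀ i, ψ x i - y i ∈ I) :
    Function.Surjective ψ := by
  rw [← LinearMap.range_eq_top, ← top_le_iff]
  refine Submodule.le_of_le_smul_of_le_jacobson_bot (I := I) Module.Finite.fg_top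
    (hI.trans (IsLocalRing.maximalIdeal_le_jacobson _)) fun y _ => ?_
  obtain ⟨x, hx⟩ := h y
  have hy : y = ψ x + -(ψ x - y) := by abel
  rw [hy]
  refine Submodule.add_mem_sup ⟨x, rfl⟩ (Submodule.neg_mem _ ?_)
  rw [pi_eq_sum_univ' (ψ x - y)]
  exact Submodule.sum_mem _ fun i _ => Submodule.smul_mem_smul (hx i) trivial

/-- Ideals with generators congruent modulo `J` agree modulo `J`. -/
theorem Ideal.span_range_le_span_range_sup {R ι : Type*} [CommRing R] {f g : ι → R} {J : Ideal R}
    (h : ∀ i, f i - g i ∈ J) : Ideal.span (Set.range f) ≤ Ideal.span (Set.range g) ⊔ J := by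
  rw [Ideal.span_le]
  rintro _ ⟨i, rfl⟩
  rw [← add_sub_cancel (g i) (f i)]
  exact Submodule.add_mem_sup (Ideal.subset_span ⟨i, rfl⟩) (h i)

theorem mainTheorem6 (p : ℕ) [Fact p.Prime] (R : Type*) [CommRing R] [IsLocalRing R]
    [IsNoetherianRing R] [Algebra (ZMod p) R] [IsAdicComplete (IsLocalRing.maximalIdeal R) R]
    (hF : IsFFinite p R) (c : ℕ) (f : Fin c → R) (hf : IsParameterSequence f)
    (e : ℕ) (he : 0 < e) :
    ∃ N : ℕ, ∀ ε : Fin c → R, (∀ i, ε i ∈ IsLocalRing.maximalIdeal R ^ N) →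
      splittingNumber p e (R ⧸ Ideal.span (Set.range (f + ε))) ≤
        splittingNumber p e (R ⧸ Ideal.span (Set.range f)) := by
  have hnt (g : Fin c → R) (hg : ∀ i, g i ∈ maximalIdeal R) :
      Nontrivial (R ⧸ Ideal.span (Set.range g)) := by
    refine Ideal.Quotient.nontrivial_iff.mpr fun h => (maximalIdeal.isMaximal R).ne_top ?_
    rw [← top_le_iff, ← h, Ideal.span_le]
    rintro _ ⟨i, rfl⟩
    exact hg i
  set F := Ideal.span (Set.range f)
  have hntF := hnt f hf.1
  have hfinF := hF.finite_frobeniusPushforward_quotient e F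
  have : IsLocalRing (R ⧸ F) :=
    IsLocalRing.of_surjective' (Ideal.Quotient.mk F) Ideal.Quotient.mk_surjective
  have hloc : (maximalIdeal R).map (Ideal.Quotient.mk F) ≤ maximalIdeal (R ⧸ F) :=
    Ideal.map_le_iff_le_comap.mpr (IsLocalRing.eq_maximalIdeal
      (Ideal.comap_isMaximal_of_surjective _ Ideal.Quotient.mk_surjective)).ge
  set I := (maximalIdeal R).map (Ideal.Quotient.mk F)
  obtain ⟨k, hk, hlift⟩ := exists_pow_forall_exists_linearMap_sub_mem
    (M := FrobeniusPushforward p e (R ⧸ F)) I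
  -- The Frobenius power of `𝔪 ^ k` has radical containing `𝔪`, hence contains a power of the
  -- finitely generated ideal `𝔪`.
  have hrad : maximalIdeal R ≤ ((maximalIdeal R ^ k).map (frobeniusPow p e R)).radical := by
    intro x hx
    refine ⟨k * p ^ e, ?_⟩
    rw [pow_mul]
    exact Ideal.mem_map_of_mem (frobeniusPow p e R) (Ideal.pow_mem_pow hx k)
  obtain ⟨N₀, hN₀⟩ := Ideal.exists_pow_le_of_le_radical_of_fg hrad (IsNoetherian.noetherian _)
  refine ⟨max N₀ k, fun ε hε => ?_⟩
  have hεk (i) : ε i ∈ maximalIdeal R ^ k := Ideal.pow_le_pow_right (le_max_right _ _) (hε i)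
  have hεN (i) : ε i ∈ (maximalIdeal R ^ k).map (frobeniusPow p e R) :=
    hN₀ (Ideal.pow_le_pow_right (le_max_left _ _) (hε i))
  have hεm (i) : ε i ∈ maximalIdeal R := Ideal.pow_le_self hk.ne' (hεk i)
  set G := Ideal.span (Set.range (f + ε))
  have hntG := hnt (f + ε) fun i => Ideal.add_mem _ (hf.1 i) (hεm i)
  have hfinG := hF.finite_frobeniusPushforward_quotient e G
  obtain ⟨φ, hφ⟩ := (freeRank_isGreatest (R ⧸ G) (FrobeniusPushforward p e (R ⧸ G))).1
  refine (freeRank_isGreatest (R ⧸ F) (FrobeniusPushforward p e (R ⧸ F))).2 ?_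
  have hFG : F ≤ G ⊔ (maximalIdeal R ^ k).map (frobeniusPow p e R) :=
    Ideal.span_range_le_span_range_sup fun i => by simpa using hεN i
  have hGF : G ≤ F ⊔ maximalIdeal R ^ k :=
    Ideal.span_range_le_span_range_sup fun i => by simpa using hεk i
  choose φ' hφ' using fun i => FrobeniusPushforward.exists_linearMap_quotient hFG hGF (I ^ k)
    (Ideal.map_pow _ _ _).symm (LinearMap.proj i ∘ₗ φ)
  choose ψ hψ using fun i => hlift (φ' i)
  refine ⟨LinearMap.pi ψ, LinearMap.surjective_of_forall_exists_sub_mem I hloc _ fun y => ?_⟩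
  choose y' hy' using fun i => Ideal.Quotient.mk_surjective (y i)
  obtain ⟨x, hx⟩ := hφ fun i => Ideal.Quotient.mk G (y' i)
  obtain ⟨x, rfl⟩ := Ideal.Quotient.mk_surjective (show R ⧸ G from x)
  refine ⟨(show FrobeniusPushforward p e (R ⧸ F) from Ideal.Quotient.mk F x), fun i => ?_⟩
  refine hψ i _ _ ?_
  rw [← hy' i]
  exact (hφ' i x (y' i) (congrFun hx i)).symm
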